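/- **Setting.** Fix a dimension $d\ge 1$. Two distinct particles $i\ne j$ among $\eta$ particles live on a grid with $N\ge 2$ points $0,\tfrac1{N-1},\dots,1$ in each of the $d$ directions, with basis states $|\boldsymbol\alpha\rangle$, $\alpha^i_k\in\mathbb Z/N$. Let $X^i_k$ be the (diagonal) position operator of particle $i$ in direction $k$, with value $\alpha^i_k/(N-1)$, and let $X^i_{k,l}$ be the same operator with $\alpha^i_k$ replaced by $(\alpha^i_k+l)\bmod N$ (conjugation of $X^i_k$ by a cyclic shift). Put $$(\mathbf R^{i,j}_{k,l})^2=(X^i_{k,l}-X^j_k)^2+\sum_{m\neq k}(X^i_m-X^j_m)^2 .$$ Let $c_l$, $1\le|l|\le a$, be real stencil coefficients, not all zero (for instance the central difference coefficients of the first derivative), $\beta=\sum_{1\le |l|\le a}|c_l|$, and for a polynomial $\widetilde V$ put $$\partial^i_k\widetilde V=\sum_{1\le|l|\le a}c_l\,\widetilde V\!\left(\tfrac1{4d}(\mathbf R^{i,j}_{k,l})^2\right).$$ **Circuit.** The registers are dim, coeff, phase (one qubit), anc, sys, in the initial state $|0\rangle|0\rangle|1\rangle|0\rangle|b\rangle$.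 Let $D(d)$ and $\mathrm{PREP}$ be unitaries with $D(d)|0\rangle=\frac1{\sqrt d}\sum_{k}|k\rangle$ and $\mathrm{PREP}|0\rangle=\sum_{l}\sqrt{|c_l|/\beta}\,|l\rangle$, and for all $k,l$ let $U_{k,l}$ be a unitary on anc and sys that is an exact block encoding of $(\mathbf R^{i,j}_{k,l})^2$ with subnormalization $4d$, i.e. $4d\,\langle 0|_{anc}U_{k,l}|0\rangle_{anc}=(\mathbf R^{i,j}_{k,l})^2$. Given phases $\phi_0,\dots,\phi_n\in\mathbb R$, the circuit applies 1. $D(d)$ on dim, $\mathrm{PREP}$ on coeff, and $e^{i\phi_0Z}$ on phase; 2. for $t=1,\dots,n$: the block encoding $U_{k,l}$ controlled on $|k\rangle_{dim}|l\rangle_{coeff}$ (its adjoint if $t$ is even; this is the same gate if the block encodings are Hermitian), then $e^{i\phi_tZ}$ on phase controlled on anc being $|0\rangle$; 3. the sign gate $|l\rangle\mapsto \mathrm{sign}(c_l)|l\rangle$ and then $\mathrm{PREP}^\dagger$ on coeff, and $X$ on phase; and postselects coeff, phase and anc on $|0\rangle$ (without renormalization), keeping dim and sys. **Theorem.** (a)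 Let $P,Q\in\mathbb C[x]$ satisfy $\deg P\le n$, $\deg Q\le n-1$ ($Q=0$ if $n=0$), $P$ has parity $n \bmod 2$, $Q$ has parity $n-1 \bmod 2$, and $|P(x)|^2+(1-x^2)|Q(x)|^2=1$ for all $x\in[-1,1]$. Then there are phases $\phi_0,\dots,\phi_n\in\mathbb R$, depending only on $P,Q,n$, such that for every $d\ge1$ and for all choices of the data above, the postselected output of the circuit on every input $|b\rangle$ is exactly $$\frac1{\beta\sqrt d}\sum_{k}|k\rangle\,\partial^i_k\widetilde V\,|b\rangle,\qquad \widetilde V=P.$$ (b) Let $V_{LJ}(r)=4\varepsilon\big((\sigma/r)^{12}-(\sigma/r)^6\big)$ with $\varepsilon,\sigma>0$, let $d\ge1$, let $\delta>0$ be a cutoff, and let $\Lambda>0$ be such that $|V_{LJ}(r)|\le\Lambda$ for all $r\in[\delta,\sqrt d]$. For every $\tau>0$ there are $n$, polynomials $(\widetilde V,Q)$ that satisfy the conditions of (a) with $P=\widetilde V$, and phases $\phi_0,\dots,\phi_n\in\mathbb R$ such that $$\Big|\widetilde V\big(r^2/(4d)\big)-V_{LJ}(r)/\Lambda\Big|\le\tau\qquad\text{for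 all } r\in[\delta,\sqrt d],$$ and for all choices of $\eta,N,i,j,a,c$, register sizes, $D(d)$, $\mathrm{PREP}$ and $U_{k,l}$, the postselected output of the circuit on every input $|b\rangle$ is exactly $\frac1{\beta\sqrt d}\sum_{k}|k\rangle\,\partial^i_k\widetilde V\,|b\rangle$. Thus the circuit outputs a finite-difference combination of a polynomial approximation to the (rescaled) Lennard-Jones potential, evaluated at the shifted distance operators. -/

import Mathlib

open scoped Matrix Kronecker

noncomputable section

namespace LJCircuit

/-! ### Quantum signal processing pairs -/

/-- `(P, Q)` is an admissible pair of QSP polynomials for `D` signal calls: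
`deg P ≤ D`, `deg Q ≤ D - 1`, `P` has the parity of `D`, `Q` has the parity of `D - 1`,
and `|P(x)|² + (1 - x²) |Q(x)|² = 1` on `[-1, 1]`. -/
structure IsQSPPair (D : ℕ) (P Q : Polynomial ℂ) : Prop where
  degree_P : P.degree ≤ (D : WithBot ℕ)
  degree_Q : Q.degree < (D : WithBot ℕ)
  parity_P : ∀ n, P.coeff n ≠ 0 → n % 2 = D % 2
  parity_Q : ∀ n, Q.coeff n ≠ 0 → n % 2 = (D + 1) % 2
  normalized : ∀ x : ℝ, x ∈ Set.Icc (-1 : ℝ) 1 →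
    ‖P.eval (x : ℂ)‖ ^ 2 + (1 - x ^ 2) * ‖Q.eval (x : ℂ)‖ ^ 2 = 1

/-! ### The Lennard-Jones potential -/

/-- `V_LJ(r) = 4 ε ((σ / r)¹² - (σ / r)⁶)`. -/
def lennardJones (ε σ r : ℝ) : ℝ := 4 * ε * ((σ / r) ^ 12 - (σ / r) ^ 6)

/-! ### Operators on the grid -/

/-- Basis states of the system register: `α i k` is the grid coordinate (modulo `N`) of
particle `i` in direction `k`. -/
abbrev Config (η d N : ℕ) : Type := Fin η → Fin d → ZMod N

/-- Position operator `X_k^i`, with grid points `0, 1/(N-1), …, 1` in each direction. -/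
def posOp {η d N : ℕ} [NeZero N] (i : Fin η) (k : Fin d) :
    Matrix (Config η d N) (Config η d N) ℂ :=
  Matrix.diagonal fun α => ((α i k).val : ℂ) / ((N : ℂ) - 1)

/-- The configuration in which coordinate `k` of particle `i` is increased by `l` modulo `N`. -/
def shiftConfig {η d N : ℕ} (i : Fin η) (k : Fin d) (l : ℤ) (α : Config η d N) :
    Config η d N :=
  Function.update α i (Function.update (α i) k (α i k + (l : ZMod N)))

/-- The `l`-th power of the cyclic shift of coordinate `k` of particle `i`:
it maps `|α⟩` to `|shiftConfig i k l α⟩`. -/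
def shiftOp {η d N : ℕ} [NeZero N] (i : Fin η) (k : Fin d) (l : ℤ) :
    Matrix (Config η d N) (Config η d N) ℂ :=
  Matrix.of fun α' α => if α' = shiftConfig i k l α then 1 else 0

/-- The position operator `X_k^i` evaluated at the coordinate shifted by `l`. On one register
it is `(N-1)⁻¹ diag(l, l+1, …, N-1, 0, …, l-1)` for `0 ≤ l < N`. -/
def shiftedPosOp {η d N : ℕ} [NeZero N] (i : Fin η) (k : Fin d) (l : ℤ) :
    Matrix (Config η d N) (Config η d N) ℂ :=
  shiftOp i k (-l) * posOp i k * shiftOp i k l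

/-- The squared distance operator `(R^{i,j}_{k,l})²` between particles `i` and `j`, where
particle `i` is shifted by `l` grid points in direction `k`. -/
def shiftedSqDist {η d N : ℕ} [NeZero N] (i j : Fin η) (k : Fin d) (l : ℤ) :
    Matrix (Config η d N) (Config η d N) ℂ :=
  (shiftedPosOp i k l - posOp j k) ^ 2 +
    ∑ m ∈ Finset.univ.erase k, (posOp i m - posOp j m) ^ 2

/-- Subnormalization `4 d` of the block encodings of the squared distance operators
(the coordinates lie in `[0, 1]`). -/
def distScale (d : ℕ) : ℝ := 4 * d

/-! ### Finite differences -/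

/-- Labels `l` with `1 ≤ |l| ≤ a`. -/
def stencil (a : ℕ) : Finset ℤ := (Finset.Icc (-(a : ℤ)) (a : ℤ)).erase 0

/-- The sum of the absolute values of the stencil coefficients. -/
def stencilNorm (a : ℕ) (c : ℤ → ℝ) : ℝ := ∑ l ∈ stencil a, |c l|

/-- `∂_k^i V = ∑_{1 ≤ |l| ≤ a} c_l V((R^{i,j}_{k,l})²)`, where the polynomial `V` takes as
argument the squared distance divided by the subnormalization. -/
def partialOp {η d N : ℕ} [NeZero N] (a : ℕ) (c : ℤ → ℝ) (V : Polynomial ℂ)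
    (i j : Fin η) (k : Fin d) : Matrix (Config η d N) (Config η d N) ℂ :=
  ∑ l ∈ stencil a, (c l : ℂ) •
    Polynomial.aeval (((distScale d)⁻¹ : ℂ) • shiftedSqDist (N := N) i j k l) V

/-! ### Block encodings and gates -/

/-- `U` is an exact block encoding of `A` with subnormalization `lam` and `m` ancilla qubits:
`U` is unitary and `A = lam (⟨0| ⊗ I) U (|0⟩ ⊗ I)`. -/
def IsBlockEncoding {S : Type} [Fintype S] [DecidableEq S] {m : ℕ} (lam : ℝ)
    (U : Matrix (Fin (2 ^ m) × S) (Fin (2 ^ m) × S) ℂ) (A : Matrix S S ℂ) : Prop :=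
  U ∈ Matrix.unitaryGroup (Fin (2 ^ m) × S) ℂ ∧
    A = (lam : ℂ) • U.submatrix (fun s => (0, s)) (fun s => (0, s))

/-- Basis states of all registers, in the order `dim`, `coeff`, `phase`, `anc`, `sys`, with
`r`, `q`, `1`, `m` qubits in the first four registers. -/
abbrev Reg (r q m : ℕ) (S : Type) : Type :=
  Fin (2 ^ r) × Fin (2 ^ q) × Fin 2 × Fin (2 ^ m) × S

/-- The gate `e^{i φ Z}`. -/
def zRot (φ : ℝ) : Matrix (Fin 2) (Fin 2) ℂ :=
  !![Complex.exp (Complex.I * φ), 0; 0, Complex.exp (-(Complex.I * φ))]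

/-- The gate `X`. -/
def xGate : Matrix (Fin 2) (Fin 2) ℂ := !![0, 1; 1, 0]

/-- The projector `|x⟩⟨x|`. -/
def proj {n : ℕ} (x : Fin n) : Matrix (Fin n) (Fin n) ℂ := Matrix.single x x 1

section Gates

variable {r q m : ℕ} {S : Type} [Fintype S] [DecidableEq S]

/-- The block encodings `U κ ℓ`, acting on `anc` and `sys`, controlled on the basis states
`κ` of `dim` and `ℓ` of `coeff`. -/
def selectGate
    (U : Fin (2 ^ r) → Fin (2 ^ q) → Matrix (Fin (2 ^ m) × S) (Fin (2 ^ m) × S) ℂ) :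
    Matrix (Reg r q m S) (Reg r q m S) ℂ :=
  ∑ κ, ∑ ℓ, proj κ ⊗ₖ (proj ℓ ⊗ₖ ((1 : Matrix (Fin 2) (Fin 2) ℂ) ⊗ₖ U κ ℓ))

/-- The gate `e^{i φ Z}` on `phase`, controlled on `anc` being in the all zero state. -/
def ctrlPhase (φ : ℝ) : Matrix (Reg r q m S) (Reg r q m S) ℂ :=
  (1 : Matrix (Fin (2 ^ r)) (Fin (2 ^ r)) ℂ) ⊗ₖ
    ((1 : Matrix (Fin (2 ^ q)) (Fin (2 ^ q)) ℂ) ⊗ₖ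
      (zRot φ ⊗ₖ (proj (0 : Fin (2 ^ m)) ⊗ₖ (1 : Matrix S S ℂ)) +
        (1 : Matrix (Fin 2) (Fin 2) ℂ) ⊗ₖ
          ((1 - proj (0 : Fin (2 ^ m))) ⊗ₖ (1 : Matrix S S ℂ))))

/-- The signs of the coefficients, `∑_l sign(c_l) |l⟩⟨l|`, on the `coeff` register, where the
label `l` is stored as the basis state `enc l`. -/
def signGate (a : ℕ) (c : ℤ → ℝ) (enc : ℤ → Fin (2 ^ q)) :
    Matrix (Fin (2 ^ q)) (Fin (2 ^ q)) ℂ :=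
  open Classical in
  Matrix.diagonal fun ℓ => if ∃ l ∈ stencil a, enc l = ℓ ∧ c l < 0 then -1 else 1

/-- The `D` rounds of QSP, the later ones to the left. Round `j` (counted from `0`) calls the
controlled block encoding, or its adjoint if `j` is odd, and then applies the controlled phase
gate with angle `φ (j + 1)`. For Hermitian block encodings all calls are the same gate. -/
def qspRounds {D : ℕ} (φ : Fin (D + 1) → ℝ)
    (U : Fin (2 ^ r) → Fin (2 ^ q) → Matrix (Fin (2 ^ m) × S) (Fin (2 ^ m) × S) ℂ) :
    Matrix (Reg r q m S) (Reg r q m S) ℂ :=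
  (List.ofFn fun j : Fin D =>
    ctrlPhase (φ j.succ) *
      (if Even (j : ℕ) then selectGate U else (selectGate U)ᴴ)).reverse.prod

/-- The whole circuit. First layer: `diff` on `dim`, `prep` on `coeff`, `e^{i φ₀ Z}` on `phase`;
then the QSP rounds; last layer: the signs of the coefficients and `prep†` on `coeff`,
`X` on `phase`. -/
def gradCircuit {D : ℕ} (φ : Fin (D + 1) → ℝ) (a : ℕ) (c : ℤ → ℝ) (enc : ℤ → Fin (2 ^ q))
    (diff : Matrix (Fin (2 ^ r)) (Fin (2 ^ r)) ℂ) (prep : Matrix (Fin (2 ^ q)) (Fin (2 ^ q)) ℂ)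
    (U : Fin (2 ^ r) → Fin (2 ^ q) → Matrix (Fin (2 ^ m) × S) (Fin (2 ^ m) × S) ℂ) :
    Matrix (Reg r q m S) (Reg r q m S) ℂ :=
  ((1 : Matrix (Fin (2 ^ r)) (Fin (2 ^ r)) ℂ) ⊗ₖ
      ((prepᴴ * signGate a c enc) ⊗ₖ (xGate ⊗ₖ (1 : Matrix (Fin (2 ^ m) × S) _ ℂ)))) *
    qspRounds φ U *
    (diff ⊗ₖ (prep ⊗ₖ (zRot (φ 0) ⊗ₖ (1 : Matrix (Fin (2 ^ m) × S) _ ℂ))))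

/-- The input state `|0⟩_dim |0⟩_coeff |1⟩_phase |0⟩_anc |b⟩_sys`. -/
def inputState (b : S → ℂ) : Reg r q m S → ℂ := fun x =>
  if x.1 = 0 ∧ x.2.1 = 0 ∧ x.2.2.1 = 1 ∧ x.2.2.2.1 = 0 then b x.2.2.2.2 else 0

/-- Postselection of `coeff`, `phase` and `anc` on the all zero state (without
renormalization); the registers `dim` and `sys` remain. -/
def postselect (ψ : Reg r q m S → ℂ) : Fin (2 ^ r) × S → ℂ := fun x => ψ (x.1, 0, 0, 0, x.2)

end Gates

/-- With the phases `φ`, the postselected circuit outputs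
`(β √d)⁻¹ ∑_k |k⟩ ∂_k^i V |b⟩` on every input `|b⟩`, for all numbers of particles and grid
points, all pairs of particles, all real stencil coefficients that do not all vanish, all
sizes of the registers that can hold the labels, all unitaries `diff` and `prep` that prepare
the uniform superposition and the coefficient state, and all block encodings of the shifted
squared distance operators (the unitaries `U κ ℓ` at unused labels are arbitrary). -/
def OutputsGradient (d : ℕ) {D : ℕ} (φ : Fin (D + 1) → ℝ) (V : Polynomial ℂ) : Prop :=
  ∀ (η N : ℕ) [NeZero N], 2 ≤ N →
  ∀ (i j : Fin η), i ≠ j →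
  ∀ (a : ℕ) (c : ℤ → ℝ), 0 < stencilNorm a c →
  ∀ (r q m : ℕ) (hr : d ≤ 2 ^ r) (enc : ℤ → Fin (2 ^ q)), Set.InjOn enc (stencil a) →
  ∀ diff ∈ Matrix.unitaryGroup (Fin (2 ^ r)) ℂ,
    diff *ᵥ Pi.single 0 1 =
      ((1 / √(d : ℝ) : ℝ) : ℂ) • ∑ k : Fin d, Pi.single (Fin.castLE hr k) 1 →
  ∀ prep ∈ Matrix.unitaryGroup (Fin (2 ^ q)) ℂ,
    prep *ᵥ Pi.single 0 1 =
      ∑ l ∈ stencil a, ((√(|c l| / stencilNorm a c) : ℝ) : ℂ) • Pi.single (enc l) 1 →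
  ∀ U : Fin (2 ^ r) → Fin (2 ^ q) →
      Matrix (Fin (2 ^ m) × Config η d N) (Fin (2 ^ m) × Config η d N) ℂ,
    (∀ κ ℓ, U κ ℓ ∈ Matrix.unitaryGroup (Fin (2 ^ m) × Config η d N) ℂ) →
    (∀ k : Fin d, ∀ l ∈ stencil a,
      IsBlockEncoding (distScale d) (U (Fin.castLE hr k) (enc l)) (shiftedSqDist i j k l)) →
  ∀ b : Config η d N → ℂ,
    postselect (gradCircuit φ a c enc diff prep U *ᵥ inputState b) =
      ((1 / (stencilNorm a c * √(d : ℝ)) : ℝ) : ℂ) •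
        ∑ k : Fin d, fun x : Fin (2 ^ r) × Config η d N =>
          (Pi.single (Fin.castLE hr k) 1 : Fin (2 ^ r) → ℂ) x.1 *
            (partialOp a c V i j k *ᵥ b) x.2

end LJCircuit

end

/-!
The circuit never mixes the basis states of `dim` and `coeff`, and `phase` stays in the state `|1⟩`
until the last layer. In a branch that selects a block encoding `U` of a Hermitian matrix `A`
(rescaled to subnormalization `1`), write `E = |0⟩_anc ⊗ I`. The parts `B = U E - E A` and
`B' = U† E - E A` have no component on `anc = |0⟩`, and unitarity gives
`U (E R + B' T) = E (A R + (1 - A²) T) + B (R - A T)`, and the same with `U` and `U†` exchanged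
(`signal_mul`). So the state after `t` rounds is `E P_t(A) + B Q_t(A)` for odd `t`, with
`B'` in place of `B` for even `t`, where
`P_{t+1} = e^{-iφ_{t+1}} (x P_t + (1 - x²) Q_t)`, `Q_{t+1} = P_t - x Q_t` and
`(P_0, Q_0) = (e^{-iφ₀}, 0)` (`qspPoly`, `branchRounds_mul_ancEmb`). No spectral decomposition is
needed: only the self-adjointness of the squared distance operators enters. The preparation, the
sign gate and the inverse preparation on `coeff` turn the branches into the sum with weights
`c_l / β` (`outputsGradient_of_qspPoly`).

Every admissible pair arises from this recursion (`IsQSPPair.exists_phases`): the recursion step is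
an involution up to the phase; the normalization forces the leading coefficients of `P` and `Q` to
have the same modulus, so that for a suitable phase the inverse step lowers both degrees.

For the Lennard-Jones potential, the target is a continuous real function `f` of `x = r² / (4 d)` on
`[a, 1/4]` with `|f| ≤ 1`. Weierstrass approximation yields an odd real polynomial `x w(x²)` that is
close to `f` there and bounded by `1` on `[-1, 1]`. With `M` odd and large,
`V = x (1 - x^{2M}) w(x²) + i x^M` is still close to `f`, and `1 - |V|² = (1 - x²) H(x²)` with `H`
nonnegative on the whole real line (`exists_isQSPPair`). A nonnegative real polynomial is a squared
modulus `|K|²` (`exists_norm_sq_eval_eq`), and `Q = K(x²)` completes the pair.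
-/

noncomputable section

namespace LJCircuit

open Polynomial

/-! ### Admissible pairs and phases -/

/-- The pair of polynomials `(P_t, Q_t)` generated by the first `t` rounds of signal processing
with the phases `φ`. -/
def qspPoly (φ : ℕ → ℝ) : ℕ → ℂ[X] × ℂ[X]
  | 0 => (C (Complex.exp (-(Complex.I * φ 0))), 0)
  | t + 1 =>
    (C (Complex.exp (-(Complex.I * φ (t + 1)))) *
        (X * (qspPoly φ t).1 + (1 - X ^ 2) * (qspPoly φ t).2),
      (qspPoly φ t).1 - X * (qspPoly φ t).2)

lemma qspPoly_congr {φ ψ : ℕ → ℝ} {t : ℕ} (h : ∀ s ≤ t, φ s = ψ s) :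
    qspPoly φ t = qspPoly ψ t := by
  induction t with
  | zero => simp [qspPoly, h 0 le_rfl]
  | succ t ih => simp [qspPoly, ih fun s hs => h s (by omega), h (t + 1) le_rfl]

lemma exists_phase {z w : ℂ} (h : ‖z‖ = ‖w‖) :
    ∃ φ : ℝ, Complex.exp (Complex.I * φ) * z = w := by
  refine ⟨w.arg - z.arg, ?_⟩
  have hz := Complex.norm_mul_exp_arg_mul_I z
  have hw := Complex.norm_mul_exp_arg_mul_I w
  rw [h] at hz
  calc _ = Complex.exp (Complex.I * ((w.arg - z.arg : ℝ) : ℂ)) *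
        (‖w‖ * Complex.exp (z.arg * Complex.I)) := by rw [hz]
    _ = ‖w‖ * Complex.exp (w.arg * Complex.I) := by
      rw [mul_left_comm, ← Complex.exp_add]
      congr 2
      push_cast
      ring
    _ = w := hw

/-- The polynomial whose values at real points are the complex conjugates of those of `P`. -/
def conjPoly (P : ℂ[X]) : ℂ[X] := P.map (starRingEnd ℂ)

lemma eval_conjPoly (P : ℂ[X]) (x : ℝ) :
    (conjPoly P).eval (x : ℂ) = starRingEnd ℂ (P.eval (x : ℂ)) := by
  have h := Polynomial.hom_eval₂ P (RingHom.id ℂ) (starRingEnd ℂ) (x : ℂ)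
  rw [Complex.conj_ofReal] at h
  rw [conjPoly, eval_map, ← RingHom.comp_id (starRingEnd ℂ), ← h, eval₂_id]
  rfl

lemma eval_mul_conjPoly (P : ℂ[X]) (x : ℝ) :
    (P * conjPoly P).eval (x : ℂ) = ((‖P.eval (x : ℂ)‖ ^ 2 : ℝ) : ℂ) := by
  rw [eval_mul, eval_conjPoly, Complex.mul_conj, Complex.normSq_eq_norm_sq]

/-- The normalization on `[-1, 1]` is an identity of polynomials. -/
lemma IsQSPPair.mul_conj_add {D : ℕ} {P Q : ℂ[X]} (h : IsQSPPair D P Q) :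
    P * conjPoly P + (1 - X ^ 2) * (Q * conjPoly Q) = 1 := by
  refine eq_of_infinite_eval_eq _ _
    (Set.Infinite.mono ?_ ((Set.Icc_infinite (show (-1 : ℝ) < 1 by norm_num)).image
      (Complex.ofReal_injective.injOn)))
  rintro _ ⟨x, hx, rfl⟩
  have := h.normalized x hx
  simp only [Set.mem_ofPred_eq]
  rw [eval_add, eval_mul_conjPoly, eval_mul, eval_mul_conjPoly]
  simp only [eval_sub, eval_pow, eval_X, eval_one]
  exact_mod_cast this

/-- The leading coefficients of an admissible pair have the same modulus: this is what allows a
phase to be split off. -/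
lemma IsQSPPair.norm_coeff_eq {D : ℕ} {P Q : ℂ[X]} (h : IsQSPPair (D + 1) P Q) :
    ‖P.coeff (D + 1)‖ = ‖Q.coeff D‖ := by
  have hP : P.natDegree ≤ D + 1 := natDegree_le_of_degree_le h.degree_P
  have hQ : Q.natDegree ≤ D := by
    rw [natDegree_le_iff_coeff_eq_zero]
    exact fun j hj => coeff_eq_zero_of_degree_lt (h.degree_Q.trans_le (by exact_mod_cast hj))
  have hP' : (conjPoly P).natDegree ≤ D + 1 := natDegree_map_le.trans hP
  have hQ' : (conjPoly Q).natDegree ≤ D := natDegree_map_le.trans hQ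
  have h2 : (1 - X ^ 2 : ℂ[X]).natDegree ≤ 2 := by compute_degree
  have hc := congrArg (fun p : ℂ[X] => p.coeff ((D + 1) + (D + 1))) h.mul_conj_add
  simp only [coeff_add] at hc
  rw [coeff_mul_add_eq_of_natDegree_le hP hP', show (D + 1) + (D + 1) = 2 + (D + D) by ring,
    coeff_mul_add_eq_of_natDegree_le h2 (natDegree_mul_le_of_le hQ hQ'),
    coeff_mul_add_eq_of_natDegree_le hQ hQ', conjPoly, conjPoly, coeff_map, coeff_map,
    Complex.mul_conj, Complex.mul_conj, Complex.normSq_eq_norm_sq, Complex.normSq_eq_norm_sq] at hc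
  simp [coeff_one] at hc
  have : ‖P.coeff (D + 1)‖ ^ 2 = ‖Q.coeff D‖ ^ 2 := by
    have := add_neg_eq_zero.mp hc
    exact_mod_cast this
  exact (sq_eq_sq₀ (norm_nonneg _) (norm_nonneg _)).mp this

lemma norm_sq_reflection (x : ℝ) (a b : ℂ) :
    ‖(x : ℂ) * a + (1 - (x : ℂ) ^ 2) * b‖ ^ 2 + (1 - x ^ 2) * ‖a - x * b‖ ^ 2 =
      ‖a‖ ^ 2 + (1 - x ^ 2) * ‖b‖ ^ 2 := by
  have h : (1 - (x : ℂ) ^ 2) = ((1 - x ^ 2 : ℝ) : ℂ) := by push_cast; rfl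
  rw [h]
  simp only [← Complex.normSq_eq_norm_sq, Complex.normSq_apply, Complex.add_re, Complex.add_im,
    Complex.sub_re, Complex.sub_im, Complex.re_ofReal_mul, Complex.im_ofReal_mul]
  ring

/-- One step of the descent: after a suitable phase rotation of `P`, the reflection by the signal
lowers the degrees of an admissible pair. -/
lemma IsQSPPair.exists_reflection {D : ℕ} {P Q : ℂ[X]} (h : IsQSPPair (D + 1) P Q) :
    ∃ φ : ℝ, IsQSPPair D
      (X * (C (Complex.exp (Complex.I * φ)) * P) + (1 - X ^ 2) * Q)
      (C (Complex.exp (Complex.I * φ)) * P - X * Q) := by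
  obtain ⟨φ, hφ⟩ := exists_phase h.norm_coeff_eq
  refine ⟨φ, ?_⟩
  set u := Complex.exp (Complex.I * φ) with hu
  have hP : ∀ j, D + 1 < j → P.coeff j = 0 := fun j hj =>
    coeff_eq_zero_of_degree_lt (h.degree_P.trans_lt (by exact_mod_cast hj))
  have hQ : ∀ j, D + 1 ≤ j → Q.coeff j = 0 := fun j hj =>
    coeff_eq_zero_of_degree_lt (h.degree_Q.trans_le (by exact_mod_cast hj))
  have hXP : ∀ j, (X * (C u * P) + (1 - X ^ 2) * Q).coeff j =
      (if j = 0 then 0 else u * P.coeff (j - 1)) + Q.coeff j -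
        (if j < 2 then 0 else Q.coeff (j - 2)) := by
    intro j
    rw [sub_mul, one_mul, coeff_add, coeff_sub, coeff_X_pow_mul']
    rcases j with _ | _ | j
    · simp
    · simp [coeff_X_mul]
    · simp [coeff_X_mul]
      ring
  have hPX : ∀ j, (C u * P - X * Q).coeff j =
      u * P.coeff j - (if j = 0 then 0 else Q.coeff (j - 1)) := by
    intro j
    rw [coeff_sub, coeff_C_mul]
    rcases j with _ | j <;> simp [coeff_X_mul]
  have parP : ∀ j, j % 2 ≠ (D + 1) % 2 → P.coeff j = 0 := fun j hj => by
    by_contra hne; exact hj (h.parity_P j hne)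
  have parQ : ∀ j, j % 2 ≠ (D + 1 + 1) % 2 → Q.coeff j = 0 := fun j hj => by
    by_contra hne; exact hj (h.parity_Q j hne)
  constructor
  · rw [degree_le_iff_coeff_zero]
    intro j hj
    have hj : D < j := by exact_mod_cast hj
    rw [hXP, if_neg (by omega), hQ j (by omega)]
    rcases lt_or_ge j 2 with h2 | h2
    · rw [if_pos h2, parP _ (by omega)]
      simp
    · rw [if_neg (by omega)]
      rcases Nat.lt_or_ge j (D + 2) with h3 | h3
      · rw [parP _ (by omega), parQ _ (by omega)]
        simp
      · rcases h3.eq_or_lt with rfl | h3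
        · simp [hφ]
        · rw [hP _ (by omega), hQ _ (by omega)]
          simp
  · rw [degree_lt_iff_coeff_zero]
    intro j hj
    rw [hPX]
    rcases Nat.lt_or_ge j (D + 1) with h3 | h3
    · rw [parP _ (by omega)]
      split_ifs with h0
      · simp
      · rw [parQ _ (by omega)]
        simp
    · rw [if_neg (by omega)]
      rcases h3.eq_or_lt with rfl | h3
      · simp [hφ]
      · rw [hP _ (by omega), hQ _ (by omega)]
        simp
  · intro j
    contrapose!
    intro hj
    rw [hXP, parQ j (by omega)]
    rcases j with _ | _ | j
    · simp
    · simp [parP 0 (by omega)]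
    · simp [parP (j + 1) (by omega), parQ j (by omega)]
  · intro j
    contrapose!
    intro hj
    rw [hPX, parP j (by omega)]
    rcases j with _ | j
    · simp
    · simp [parQ j (by omega)]
  · intro x hx
    have hn : ‖u‖ = 1 := by rw [hu, mul_comm, Complex.norm_exp_ofReal_mul_I]
    have := norm_sq_reflection x (u * P.eval (x : ℂ)) (Q.eval (x : ℂ))
    simp only [eval_add, eval_sub, eval_mul, eval_X, eval_C, eval_pow, eval_one]
    rw [this, norm_mul, hn, one_mul]
    exact h.normalized x hx

/-- Every admissible pair is generated by a choice of phases. -/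
theorem IsQSPPair.exists_phases {D : ℕ} {P Q : ℂ[X]} (h : IsQSPPair D P Q) :
    ∃ φ : ℕ → ℝ, qspPoly φ D = (P, Q) := by
  induction D generalizing P Q with
  | zero =>
    have hQ : Q = 0 := by
      rw [← degree_eq_bot, ← Nat.WithBot.lt_zero_iff]
      exact h.degree_Q
    obtain ⟨c, rfl⟩ : ∃ c, P = C c := ⟨_, eq_C_of_degree_le_zero h.degree_P⟩
    have hc : ‖(1 : ℂ)‖ = ‖c‖ := by
      have := h.normalized 0 (by norm_num)
      rw [norm_one]
      simp only [hQ, eval_C, eval_zero, norm_zero] at this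
      nlinarith [norm_nonneg c]
    obtain ⟨φ, hφ⟩ := exists_phase hc
    refine ⟨fun _ => -φ, ?_⟩
    rw [mul_one] at hφ
    simp [qspPoly, hQ, hφ]
  | succ D ih =>
    obtain ⟨θ, hθ⟩ := h.exists_reflection
    obtain ⟨φ, hφ⟩ := ih hθ
    refine ⟨Function.update φ (D + 1) θ, ?_⟩
    have hc : qspPoly (Function.update φ (D + 1) θ) D = qspPoly φ D :=
      qspPoly_congr fun s hs => Function.update_of_ne (by omega) _ _
    have he : C (Complex.exp (-(Complex.I * θ))) * C (Complex.exp (Complex.I * θ)) =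
        (1 : ℂ[X]) := by
      rw [← C_mul, ← Complex.exp_add, neg_add_cancel, Complex.exp_zero, C_1]
    rw [qspPoly, hc, hφ, Function.update_self, Prod.mk.injEq]
    constructor
    · linear_combination P * he
    · ring

/-! ### Signal processing in one branch -/

section Branch

variable {m : ℕ} {S : Type} [Fintype S] [DecidableEq S]

/-- The isometry `|0⟩_anc ⊗ I`. -/
def ancEmb (m : ℕ) (S : Type) [DecidableEq S] : Matrix (Fin (2 ^ m) × S) S ℂ :=
  (1 : Matrix (Fin (2 ^ m) × S) (Fin (2 ^ m) × S) ℂ).submatrix id fun s => (0, s)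

/-- Multiplication by `c` on the states with `anc` equal to `|0⟩`. -/
def ancPhase (m : ℕ) (S : Type) [DecidableEq S] (c : ℂ) :
    Matrix (Fin (2 ^ m) × S) (Fin (2 ^ m) × S) ℂ :=
  Matrix.diagonal fun x => if x.1 = 0 then c else 1

/-- The action of the first `t` rounds on `anc` and `sys`, in a branch where `phase` is `|1⟩` and
the control registers select the block encoding `U`. -/
def branchRounds (φ : ℕ → ℝ) (U : Matrix (Fin (2 ^ m) × S) (Fin (2 ^ m) × S) ℂ) :
    ℕ → Matrix (Fin (2 ^ m) × S) (Fin (2 ^ m) × S) ℂ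
  | 0 => 1
  | t + 1 => ancPhase m S (Complex.exp (-(Complex.I * φ (t + 1)))) *
      (if Even t then U else Uᴴ) * branchRounds φ U t

lemma mul_ancEmb (M : Matrix (Fin (2 ^ m) × S) (Fin (2 ^ m) × S) ℂ) :
    M * ancEmb m S = M.submatrix id (fun s => (0, s)) := by
  ext s x
  simp [ancEmb, Matrix.mul_apply, Matrix.one_apply]

lemma ancPhase_mul_ancEmb (c : ℂ) : ancPhase m S c * ancEmb m S = c • ancEmb m S := by
  ext x s
  rw [ancPhase, Matrix.diagonal_mul]
  by_cases h : x.1 = 0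
  · simp [h]
  · have : x ≠ (0, s) := fun h' => h (by rw [h'])
    simp [ancEmb, this]

/-- The part of `U (|0⟩ ⊗ I)` outside the encoded block. -/
def offBlock (U : Matrix (Fin (2 ^ m) × S) (Fin (2 ^ m) × S) ℂ) (A : Matrix S S ℂ) :
    Matrix (Fin (2 ^ m) × S) S ℂ :=
  U * ancEmb m S - ancEmb m S * A

lemma ancPhase_mul_offBlock {U : Matrix (Fin (2 ^ m) × S) (Fin (2 ^ m) × S) ℂ}
    {A : Matrix S S ℂ} (hA : U.submatrix (fun s => (0, s)) (fun s => (0, s)) = A) (c : ℂ) :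
    ancPhase m S c * offBlock U A = offBlock U A := by
  ext x s
  obtain ⟨y, t⟩ := x
  rw [ancPhase, Matrix.diagonal_mul]
  by_cases h : y = 0
  · subst h
    have : offBlock U A (0, t) s = 0 := by
      rw [offBlock, mul_ancEmb, ← hA]
      simp [ancEmb, Matrix.mul_apply, Matrix.one_apply]
    rw [this, mul_zero]
  · simp [h]

/-- One call of a unitary `W` whose encoded block is `A`: it reflects the plane spanned by the
encoded block and its complement. -/
lemma signal_mul {W : Matrix (Fin (2 ^ m) × S) (Fin (2 ^ m) × S) ℂ} (hW : W * Wᴴ = 1)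
    (A R T : Matrix S S ℂ) :
    W * (ancEmb m S * R + offBlock Wᴴ A * T) =
      ancEmb m S * (A * R + (1 - A ^ 2) * T) + offBlock W A * (R - A * T) := by
  have h : W * (Wᴴ * ancEmb m S) = ancEmb m S := by
    rw [← Matrix.mul_assoc, hW, Matrix.one_mul]
  simp only [offBlock, Matrix.mul_add, Matrix.mul_sub, Matrix.sub_mul, pow_two,
    Matrix.one_mul, ← Matrix.mul_assoc] at h ⊢
  rw [h]
  abel

/-- In the branch of a block encoding of a Hermitian matrix `A`, the rounds evaluate the
polynomials generated by the phases at `A`. -/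
lemma branchRounds_mul_ancEmb (φ : ℕ → ℝ) {U : Matrix (Fin (2 ^ m) × S) (Fin (2 ^ m) × S) ℂ}
    (hU : U ∈ Matrix.unitaryGroup (Fin (2 ^ m) × S) ℂ) {A : Matrix S S ℂ} (hAh : A.IsHermitian)
    (hA : U.submatrix (fun s => (0, s)) (fun s => (0, s)) = A) (t : ℕ) :
    branchRounds φ U t * (Complex.exp (-(Complex.I * φ 0)) • ancEmb m S) =
      ancEmb m S * aeval A (qspPoly φ t).1 +
        offBlock (if Even t then Uᴴ else U) A * aeval A (qspPoly φ t).2 := by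
  have hA' : Uᴴ.submatrix (fun s => (0, s)) (fun s => (0, s)) = A := by
    rw [← Matrix.conjTranspose_submatrix, hA, hAh.eq]
  have h1 : U * Uᴴ = 1 := Matrix.mem_unitaryGroup_iff.mp hU
  have h2 : Uᴴ * Uᴴᴴ = 1 := by
    rw [Matrix.conjTranspose_conjTranspose]
    exact Matrix.mem_unitaryGroup_iff'.mp hU
  induction t with
  | zero =>
    simp [branchRounds, qspPoly, Algebra.algebraMap_eq_smul_one]
  | succ t ih =>
    have key : ∀ W : Matrix (Fin (2 ^ m) × S) (Fin (2 ^ m) × S) ℂ, W * Wᴴ = 1 →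
        W.submatrix (fun s => (0, s)) (fun s => (0, s)) = A → ∀ c : ℂ,
        ancPhase m S c * W * (ancEmb m S * aeval A (qspPoly φ t).1 +
          offBlock Wᴴ A * aeval A (qspPoly φ t).2) =
        ancEmb m S * aeval A (C c *
          (X * (qspPoly φ t).1 + (1 - X ^ 2) * (qspPoly φ t).2)) +
        offBlock W A * aeval A ((qspPoly φ t).1 - X * (qspPoly φ t).2) := by
      intro W hW hWA c
      rw [Matrix.mul_assoc, signal_mul hW, Matrix.mul_add, ← Matrix.mul_assoc,
        ← Matrix.mul_assoc, ancPhase_mul_ancEmb, ancPhase_mul_offBlock hWA,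
        Matrix.smul_mul, ← Matrix.mul_smul]
      simp [Algebra.algebraMap_eq_smul_one]
    rw [branchRounds, Matrix.mul_assoc _ (branchRounds φ U t), ih]
    by_cases ht : Even t
    · simp only [ht, Nat.even_add_one, not_true_eq_false, if_true, if_false]
      exact key U h1 hA _
    · have := key Uᴴ h2 hA' (Complex.exp (-(Complex.I * φ (t + 1))))
      rw [Matrix.conjTranspose_conjTranspose] at this
      simp only [ht, Nat.even_add_one, not_false_eq_true, if_true, if_false]
      exact this

/-- The encoded block of the rounds is the first polynomial at `A`. -/
lemma branchRounds_submatrix (φ : ℕ → ℝ) {U : Matrix (Fin (2 ^ m) × S) (Fin (2 ^ m) × S) ℂ}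
    (hU : U ∈ Matrix.unitaryGroup (Fin (2 ^ m) × S) ℂ) {A : Matrix S S ℂ} (hAh : A.IsHermitian)
    (hA : U.submatrix (fun s => (0, s)) (fun s => (0, s)) = A) (t : ℕ) :
    Complex.exp (-(Complex.I * φ 0)) •
      (branchRounds φ U t).submatrix (fun s => (0, s)) (fun s => (0, s)) =
      aeval A (qspPoly φ t).1 := by
  have hA' : Uᴴ.submatrix (fun s => (0, s)) (fun s => (0, s)) = A := by
    rw [← Matrix.conjTranspose_submatrix, hA, hAh.eq]
  -- `offBlock W A` has no component on `anc = |0⟩`: it is fixed by the multiplication by `0` there.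
  have hoff : ∀ (W : Matrix (Fin (2 ^ m) × S) (Fin (2 ^ m) × S) ℂ),
      W.submatrix (fun s => (0, s)) (fun s => (0, s)) = A → ∀ s' s,
      offBlock W A (0, s') s = 0 := by
    intro W hW s' s
    have := congrFun (congrFun (ancPhase_mul_offBlock hW 0) (0, s')) s
    rw [ancPhase, Matrix.diagonal_mul] at this
    simpa using this.symm
  ext s s'
  have h := congrFun (congrFun (branchRounds_mul_ancEmb φ hU hAh hA t) (0, s)) s'
  rw [Matrix.mul_smul, mul_ancEmb, Matrix.add_apply, Matrix.mul_apply (M := offBlock _ _),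
    Finset.sum_eq_zero fun x _ => by
      rw [hoff _ (by split_ifs <;> assumption), zero_mul]] at h
  simpa [ancEmb, Matrix.mul_apply, Matrix.one_apply] using h

end Branch

/-! ### The gates of the circuit on the branches -/

lemma kronecker_mulVec_mul {α β : Type*} [Fintype α] [Fintype β] (A : Matrix α α ℂ)
    (B : Matrix β β ℂ) (u : α → ℂ) (v : β → ℂ) :
    (A ⊗ₖ B) *ᵥ (fun x => u x.1 * v x.2) = fun x => (A *ᵥ u) x.1 * (B *ᵥ v) x.2 := by
  ext x
  simp only [Matrix.mulVec, dotProduct, Matrix.kroneckerMap_apply, Fintype.sum_prod_type,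
    Finset.sum_mul_sum]
  exact Finset.sum_congr rfl fun _ _ => Finset.sum_congr rfl fun _ _ => by ring

section Gates

variable {r q m : ℕ} {S : Type}

lemma selectGate_apply
    (U : Fin (2 ^ r) → Fin (2 ^ q) → Matrix (Fin (2 ^ m) × S) (Fin (2 ^ m) × S) ℂ)
    (κ κ' : Fin (2 ^ r)) (ℓ ℓ' : Fin (2 ^ q)) (p p' : Fin 2) (x y : Fin (2 ^ m) × S) :
    selectGate U (κ, ℓ, p, x) (κ', ℓ', p', y) =
      if p = p' then if ℓ = ℓ' then if κ = κ' then U κ ℓ x y else 0 else 0 else 0 := by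
  simp only [selectGate, Matrix.sum_apply, Matrix.kroneckerMap_apply, proj, Matrix.single_apply,
    Matrix.one_apply]
  rw [Finset.sum_eq_single κ, Finset.sum_eq_single ℓ]
  · simp
  · intro b _ hb
    simp [hb]
  · simp
  · intro b _ hb
    simp [hb]
  · simp

lemma selectGate_mulVec [Fintype S]
    (U : Fin (2 ^ r) → Fin (2 ^ q) → Matrix (Fin (2 ^ m) × S) (Fin (2 ^ m) × S) ℂ)
    (ψ : Reg r q m S → ℂ) (κ : Fin (2 ^ r)) (ℓ : Fin (2 ^ q)) (p : Fin 2)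
    (x : Fin (2 ^ m) × S) :
    (selectGate U *ᵥ ψ) (κ, ℓ, p, x) = (U κ ℓ *ᵥ fun y => ψ (κ, ℓ, p, y)) x := by
  simp only [Matrix.mulVec, dotProduct]
  rw [Fintype.sum_prod_type, Finset.sum_eq_single κ, Fintype.sum_prod_type,
    Finset.sum_eq_single ℓ, Fintype.sum_prod_type, Finset.sum_eq_single p]
  · simp [selectGate_apply]
  · exact fun b _ hb => Finset.sum_eq_zero fun y _ => by simp [selectGate_apply, hb.symm]
  · simp
  · exact fun b _ hb => Finset.sum_eq_zero fun ⟨_, _⟩ _ => by simp [selectGate_apply, hb.symm]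
  · simp
  · exact fun b _ hb => Finset.sum_eq_zero fun ⟨_, _, _⟩ _ => by simp [selectGate_apply, hb.symm]
  · simp

lemma conjTranspose_selectGate
    (U : Fin (2 ^ r) → Fin (2 ^ q) → Matrix (Fin (2 ^ m) × S) (Fin (2 ^ m) × S) ℂ) :
    (selectGate U)ᴴ = selectGate fun κ ℓ => (U κ ℓ)ᴴ := by
  ext ⟨κ, ℓ, p, x⟩ ⟨κ', ℓ', p', y⟩
  rw [Matrix.conjTranspose_apply, selectGate_apply, selectGate_apply]
  by_cases h1 : κ = κ'
  · by_cases h2 : ℓ = ℓ'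
    · by_cases h3 : p = p'
      · simp [h1, h2, h3]
      · simp [h3, Ne.symm h3]
    · simp [h2, Ne.symm h2]
  · simp [h1, Ne.symm h1]

lemma zRot_one_one (φ : ℝ) : zRot φ 1 1 = Complex.exp (-(Complex.I * φ)) := by simp [zRot]

/-- The last layer on the coefficient register, postselected on `|0⟩`, is the linear functional
with the signed conjugate amplitudes of the prepared state. -/
lemma prep_sign_apply (a : ℕ) (c : ℤ → ℝ) (enc : ℤ → Fin (2 ^ q))
    (prep : Matrix (Fin (2 ^ q)) (Fin (2 ^ q)) ℂ) (ℓ : Fin (2 ^ q)) :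
    (prepᴴ * signGate a c enc) 0 ℓ =
      starRingEnd ℂ ((prep *ᵥ Pi.single 0 1) ℓ) * signGate a c enc ℓ ℓ := by
  simp [signGate, Matrix.mul_diagonal]

variable [DecidableEq S]

lemma ctrlPhase_eq_diagonal (φ : ℝ) :
    (ctrlPhase φ : Matrix (Reg r q m S) (Reg r q m S) ℂ) =
      Matrix.diagonal fun x => if x.2.2.2.1 = 0 then zRot φ x.2.2.1 x.2.2.1 else 1 := by
  have hz : zRot φ = Matrix.diagonal fun p => zRot φ p p := by
    ext i j
    fin_cases i <;> fin_cases j <;> simp [zRot]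
  have hp : (proj (0 : Fin (2 ^ m))) = Matrix.diagonal fun x => if x = 0 then 1 else 0 := by
    rw [proj, ← Matrix.diagonal_single]
    congr 1
    ext x
    simp [Pi.single_apply]
  rw [ctrlPhase, hz, hp]
  simp only [← Matrix.diagonal_one, Matrix.diagonal_sub, Matrix.diagonal_kronecker_diagonal,
    Matrix.diagonal_add]
  congr 1
  ext x
  by_cases h : x.2.2.2.1 = 0 <;> simp [h]

variable [Fintype S]

lemma ctrlPhase_mulVec (φ : ℝ) (ψ : Reg r q m S → ℂ) (κ : Fin (2 ^ r)) (ℓ : Fin (2 ^ q)) :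
    (fun x => (ctrlPhase φ *ᵥ ψ) (κ, ℓ, 1, x)) =
      ancPhase m S (Complex.exp (-(Complex.I * φ))) *ᵥ fun x => ψ (κ, ℓ, 1, x) := by
  ext x
  rw [ctrlPhase_eq_diagonal, Matrix.mulVec_diagonal, ancPhase, Matrix.mulVec_diagonal,
    zRot_one_one]

lemma qspRounds_succ (φ : ℕ → ℝ) (t : ℕ)
    (U : Fin (2 ^ r) → Fin (2 ^ q) → Matrix (Fin (2 ^ m) × S) (Fin (2 ^ m) × S) ℂ) :
    qspRounds (fun j : Fin (t + 1 + 1) => φ j) U =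
      ctrlPhase (φ (t + 1)) * (if Even t then selectGate U else (selectGate U)ᴴ) *
        qspRounds (fun j : Fin (t + 1) => φ j) U := by
  rw [qspRounds, List.ofFn_succ', List.concat_eq_append, List.reverse_append]
  simp [qspRounds]

/-- The rounds preserve the branches: the states of `dim` and `coeff` and the state `|1⟩` of
`phase`. -/
lemma qspRounds_mulVec (φ : ℕ → ℝ) (t : ℕ)
    (U : Fin (2 ^ r) → Fin (2 ^ q) → Matrix (Fin (2 ^ m) × S) (Fin (2 ^ m) × S) ℂ)
    (ψ : Reg r q m S → ℂ) (κ : Fin (2 ^ r)) (ℓ : Fin (2 ^ q)) :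
    (fun x => (qspRounds (fun j : Fin (t + 1) => φ j) U *ᵥ ψ) (κ, ℓ, 1, x)) =
      branchRounds φ (U κ ℓ) t *ᵥ fun x => ψ (κ, ℓ, 1, x) := by
  induction t with
  | zero => simp [qspRounds, branchRounds]
  | succ t ih =>
    rw [qspRounds_succ, branchRounds, ← Matrix.mulVec_mulVec, ← Matrix.mulVec_mulVec,
      ctrlPhase_mulVec, ← Matrix.mulVec_mulVec, ← Matrix.mulVec_mulVec, ← ih]
    congr 1
    ext x
    split_ifs
    · rw [selectGate_mulVec]
    · rw [conjTranspose_selectGate, selectGate_mulVec]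

/-- Because of the gate `X` in the last layer, the postselection of `phase` on `|0⟩` picks the
component at `|1⟩`. -/
lemma postselect_lastLayer (L : Matrix (Fin (2 ^ q)) (Fin (2 ^ q)) ℂ) (ψ : Reg r q m S → ℂ)
    (κ : Fin (2 ^ r)) (s : S) :
    postselect (((1 : Matrix (Fin (2 ^ r)) (Fin (2 ^ r)) ℂ) ⊗ₖ
      (L ⊗ₖ (xGate ⊗ₖ (1 : Matrix (Fin (2 ^ m) × S) _ ℂ)))) *ᵥ ψ) (κ, s) =
      ∑ ℓ, L 0 ℓ * ψ (κ, ℓ, 1, 0, s) := by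
  simp only [postselect, Matrix.mulVec, dotProduct, Matrix.kroneckerMap_apply]
  rw [Fintype.sum_prod_type, Finset.sum_eq_single κ, Fintype.sum_prod_type]
  · refine Finset.sum_congr rfl fun ℓ _ => ?_
    rw [Fintype.sum_prod_type, Fin.sum_univ_two]
    rw [Finset.sum_eq_single (0, s) (f := fun x => _ * ψ (κ, ℓ, 1, x))]
    · simp [xGate]
    · intro b _ hb
      simp [hb.symm]
    · simp
  · intro b _ hb
    simp [hb.symm]
  · simp

/-- The first layer prepares in each branch the state `e^{-i φ₀} |0⟩_anc |b⟩`, weighted by the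
amplitudes of the branch. -/
lemma firstLayer_mulVec (φ : ℝ) (diff : Matrix (Fin (2 ^ r)) (Fin (2 ^ r)) ℂ)
    (prep : Matrix (Fin (2 ^ q)) (Fin (2 ^ q)) ℂ) (b : S → ℂ) (κ : Fin (2 ^ r))
    (ℓ : Fin (2 ^ q)) :
    (fun x => ((diff ⊗ₖ (prep ⊗ₖ (zRot φ ⊗ₖ
      (1 : Matrix (Fin (2 ^ m) × S) (Fin (2 ^ m) × S) ℂ)))) *ᵥ
      inputState b) (κ, ℓ, 1, x)) =
      ((diff *ᵥ Pi.single 0 1) κ * (prep *ᵥ Pi.single 0 1) ℓ) •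
        (Complex.exp (-(Complex.I * φ)) • (ancEmb m S *ᵥ b)) := by
  let v₁ : Fin 2 × Fin (2 ^ m) × S → ℂ := fun x =>
    (Pi.single 1 1 : Fin 2 → ℂ) x.1 * (ancEmb m S *ᵥ b) x.2
  let v₂ : Fin (2 ^ q) × Fin 2 × Fin (2 ^ m) × S → ℂ := fun x =>
    (Pi.single 0 1 : Fin (2 ^ q) → ℂ) x.1 * v₁ x.2
  have h : (inputState b : Reg r q m S → ℂ) = fun x =>
      (Pi.single 0 1 : Fin (2 ^ r) → ℂ) x.1 * v₂ x.2 := by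
    ext ⟨κ, ℓ, p, y, s⟩
    have he : (ancEmb m S *ᵥ b) (y, s) = if y = 0 then b s else 0 := by
      by_cases hy : y = 0 <;> simp [ancEmb, Matrix.mulVec, dotProduct, Matrix.one_apply, hy]
    simp only [inputState, v₁, v₂, he, Pi.single_apply]
    by_cases h1 : κ = 0 <;> by_cases h2 : ℓ = 0 <;> by_cases h3 : p = 1 <;> simp [h1, h2, h3]
  rw [h, kronecker_mulVec_mul diff _ _ v₂, kronecker_mulVec_mul prep _ _ v₁,
    kronecker_mulVec_mul (zRot φ) 1 _ (ancEmb m S *ᵥ b)]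
  ext x
  simp [zRot, mul_assoc]

end Gates

/-! ### The squared distance operators are Hermitian -/

section Grid

variable {η d N : ℕ}

lemma shiftConfig_neg_shiftConfig (i : Fin η) (k : Fin d) (l : ℤ) (α : Config η d N) :
    shiftConfig i k (-l) (shiftConfig i k l α) = α := by
  simp [shiftConfig]

variable [NeZero N]

lemma isHermitian_posOp (i : Fin η) (k : Fin d) :
    (posOp i k : Matrix (Config η d N) (Config η d N) ℂ).IsHermitian := by
  rw [posOp, Matrix.isHermitian_diagonal_iff]
  intro α
  rw [isSelfAdjoint_iff, Complex.star_def, map_div₀, map_sub, map_natCast, map_natCast, map_one]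

lemma conjTranspose_shiftOp (i : Fin η) (k : Fin d) (l : ℤ) :
    (shiftOp i k l : Matrix (Config η d N) (Config η d N) ℂ)ᴴ = shiftOp i k (-l) := by
  ext α β
  have : β = shiftConfig i k l α ↔ α = shiftConfig i k (-l) β := by
    constructor
    · rintro rfl
      rw [shiftConfig_neg_shiftConfig]
    · rintro rfl
      have := shiftConfig_neg_shiftConfig i k (-l) β
      rw [neg_neg] at this
      exact this.symm
  simp [shiftOp, Matrix.conjTranspose_apply, this, apply_ite]

lemma isHermitian_shiftedPosOp (i : Fin η) (k : Fin d) (l : ℤ) :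
    (shiftedPosOp i k l : Matrix (Config η d N) (Config η d N) ℂ).IsHermitian := by
  rw [shiftedPosOp, ← conjTranspose_shiftOp]
  exact Matrix.isHermitian_conjTranspose_mul_mul _ (isHermitian_posOp i k)

lemma isHermitian_shiftedSqDist (i j : Fin η) (k : Fin d) (l : ℤ) :
    (shiftedSqDist i j k l : Matrix (Config η d N) (Config η d N) ℂ).IsHermitian := by
  rw [shiftedSqDist]
  refine (((isHermitian_shiftedPosOp i k l).sub (isHermitian_posOp j k)).pow 2).add ?_
  refine isSelfAdjoint_sum _ fun m _ => ?_
  exact ((isHermitian_posOp i m).sub (isHermitian_posOp j m)).pow 2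

end Grid

/-! ### The output of the circuit -/

/-- The phases that generate `P` make the circuit output the finite difference gradient of `P`. -/
theorem outputsGradient_of_qspPoly {D : ℕ} {φ : ℕ → ℝ} {P Q : ℂ[X]} (h : qspPoly φ D = (P, Q))
    {d : ℕ} (hd : 1 ≤ d) : OutputsGradient d (fun t : Fin (D + 1) => φ t) P := by
  intro η N _ _ i j _ a c hc r q m hr enc henc diff _ hdiff' prep _ hprep' U hU hUA b
  have hs : ((distScale d : ℝ) : ℂ) ≠ 0 := by
    rw [distScale]
    exact_mod_cast (by positivity : (4 * d : ℝ) ≠ 0)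
  -- The encoded block of a branch with valid labels.
  have hblock : ∀ k : Fin d, ∀ l ∈ stencil a,
      Complex.exp (-(Complex.I * φ 0)) • (branchRounds φ (U (Fin.castLE hr k) (enc l)) D).submatrix
        (fun s => (0, s)) (fun s => (0, s)) =
      aeval (((distScale d)⁻¹ : ℂ) • shiftedSqDist (N := N) i j k l) P := by
    intro k l hl
    have hA := (hUA k l hl).2
    have := branchRounds_submatrix φ (hU (Fin.castLE hr k) (enc l))
      (A := ((distScale d)⁻¹ : ℂ) • shiftedSqDist (N := N) i j k l)
      ((isHermitian_shiftedSqDist i j k l).smul (by simp [isSelfAdjoint_iff]))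
      (by rw [hA, smul_smul, inv_mul_cancel₀ hs, one_smul]) D
    rw [h] at this
    exact this
  have hsign : ∀ l ∈ stencil a, signGate a c enc (enc l) (enc l) = if c l < 0 then -1 else 1 := by
    intro l hl
    rw [signGate, Matrix.diagonal_apply_eq]
    refine if_congr ⟨?_, fun h => ⟨l, hl, rfl, h⟩⟩ rfl rfl
    rintro ⟨l', hl', he, h'⟩
    rwa [← henc hl' hl he]
  -- Amplitude, sign and conjugate amplitude of a label multiply to `c_l / β`.
  have hcoef : ∀ l ∈ stencil a, ((√(|c l| / stencilNorm a c) : ℝ) : ℂ) *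
      (if c l < 0 then -1 else 1) * ((√(|c l| / stencilNorm a c) : ℝ) : ℂ) =
      ((c l / stencilNorm a c : ℝ) : ℂ) := by
    intro l _
    have h1 : √(|c l| / stencilNorm a c) * √(|c l| / stencilNorm a c) = |c l| / stencilNorm a c :=
      Real.mul_self_sqrt (by positivity)
    rw [mul_right_comm, ← Complex.ofReal_mul, h1]
    split_ifs with hneg
    · rw [abs_of_neg hneg]
      push_cast
      ring
    · rw [abs_of_nonneg (not_lt.mp hneg)]
      simp
  have hdiffκ : ∀ κ, (diff *ᵥ Pi.single 0 1) κ = ((1 / √(d : ℝ) : ℝ) : ℂ) *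
      ∑ k : Fin d, (Pi.single (Fin.castLE hr k) 1 : Fin (2 ^ r) → ℂ) κ := by
    intro κ
    rw [hdiff', Pi.smul_apply, Finset.sum_apply, smul_eq_mul]
  have hprepℓ : ∀ ℓ, (prep *ᵥ Pi.single 0 1) ℓ =
      ∑ l ∈ stencil a, ((√(|c l| / stencilNorm a c) : ℝ) : ℂ) *
        (Pi.single (enc l) 1 : Fin (2 ^ q) → ℂ) ℓ := by
    intro ℓ
    rw [hprep', Finset.sum_apply]
    rfl
  have hprepenc : ∀ l ∈ stencil a, (prep *ᵥ Pi.single 0 1) (enc l) =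
      ((√(|c l| / stencilNorm a c) : ℝ) : ℂ) := by
    intro l hl
    rw [hprepℓ, Finset.sum_eq_single l]
    · simp
    · intro l' hl' hne
      rw [Pi.single_eq_of_ne (fun he => hne (henc hl' hl he.symm)), mul_zero]
    · exact fun h => (h hl).elim
  ext ⟨κ, s⟩
  set ψ := (diff ⊗ₖ (prep ⊗ₖ (zRot (φ 0) ⊗ₖ
    (1 : Matrix (Fin (2 ^ m) × Config η d N) (Fin (2 ^ m) × Config η d N) ℂ)))) *ᵥ
      inputState b with hψ
  have hψ' := firstLayer_mulVec (m := m) (φ 0) diff prep b κ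
  rw [gradCircuit, ← Matrix.mulVec_mulVec, ← Matrix.mulVec_mulVec, postselect_lastLayer]
  simp only [Fin.val_zero]
  rw [← hψ] at hψ' ⊢
  clear_value ψ
  have hbranch : ∀ ℓ, (qspRounds (fun t : Fin (D + 1) => φ t) U *ᵥ ψ) (κ, ℓ, 1, 0, s) =
      ((diff *ᵥ Pi.single 0 1) κ * (prep *ᵥ Pi.single 0 1) ℓ) *
        ((Complex.exp (-(Complex.I * φ 0)) • (branchRounds φ (U κ ℓ) D).submatrix
          (fun s => (0, s)) (fun s => (0, s))) *ᵥ b) s := by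
    intro ℓ
    have := congrFun (qspRounds_mulVec φ D U ψ κ ℓ) (0, s)
    rw [hψ', Matrix.mulVec_smul, Matrix.mulVec_smul, Matrix.mulVec_mulVec,
      mul_ancEmb] at this
    rw [this, Matrix.smul_mulVec]
    rfl
  simp only [hbranch, prep_sign_apply]
  -- Only the labels of the stencil contribute to the sum over the coefficient register.
  rw [← Finset.sum_subset (Finset.subset_univ ((stencil a).image enc)), Finset.sum_image henc]
  swap
  · intro ℓ _ hℓ
    have : (prep *ᵥ Pi.single 0 1) ℓ = 0 := by
      rw [hprepℓ]
      refine Finset.sum_eq_zero fun l hl => ?_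
      rw [Pi.single_eq_of_ne, mul_zero]
      rintro rfl
      exact hℓ (Finset.mem_image_of_mem _ hl)
    simp [this]
  simp only [Pi.smul_apply, Finset.sum_apply, smul_eq_mul]
  by_cases hκ : ∃ k, Fin.castLE hr k = κ
  · obtain ⟨k, rfl⟩ := hκ
    have hinj : ∀ k', (Pi.single (Fin.castLE hr k') 1 : Fin (2 ^ r) → ℂ) (Fin.castLE hr k) =
        if k' = k then 1 else 0 := by
      intro k'
      rw [Pi.single_apply]
      exact if_congr ((Fin.castLE_injective hr).eq_iff.trans eq_comm) rfl rfl
    simp only [hdiffκ, hinj, Finset.sum_ite_eq', Finset.mem_univ, if_true, ite_mul, zero_mul,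
      one_mul, mul_one]
    rw [partialOp, Matrix.sum_mulVec, Finset.sum_apply, Finset.mul_sum]
    refine Finset.sum_congr rfl fun l hl => ?_
    rw [hblock k l hl, hprepenc l hl, hsign l hl, Complex.conj_ofReal, Matrix.smul_mulVec,
      Pi.smul_apply, smul_eq_mul]
    have := hcoef l hl
    generalize (aeval _ P *ᵥ b) s = z
    generalize ((√(|c l| / stencilNorm a c) : ℝ) : ℂ) = u at this ⊢
    push_cast at this ⊢
    linear_combination (1 / ((√(d : ℝ) : ℝ) : ℂ)) * z * this
  · have hz : ∀ k, (Pi.single (Fin.castLE hr k) 1 : Fin (2 ^ r) → ℂ) κ = 0 := fun k =>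
      Pi.single_eq_of_ne (fun he => hκ ⟨k, he.symm⟩) _
    simp [hdiffκ, hz]

/-! ### Nonnegative real polynomials as squared moduli -/

/-- A real polynomial that is nonnegative on the real line is the squared modulus of a complex
polynomial on the real line. -/
theorem exists_norm_sq_eval_eq (H : ℝ[X]) (hH : ∀ x : ℝ, 0 ≤ H.eval x) :
    ∃ K : ℂ[X], ∀ x : ℝ, ‖K.eval (x : ℂ)‖ ^ 2 = H.eval x := by
  induction h : H.natDegree using Nat.strong_induction_on generalizing H with
  | _ n ih =>
  subst h
  by_cases h0 : H.natDegree = 0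
  · obtain ⟨c, rfl⟩ := natDegree_eq_zero.mp h0
    have hc : 0 ≤ c := by simpa using hH 0
    refine ⟨C (√c : ℂ), fun x => ?_⟩
    rw [eval_C, eval_C, Complex.norm_real, Real.norm_of_nonneg (Real.sqrt_nonneg _),
      Real.sq_sqrt hc]
  have hne : H ≠ 0 := fun h => h0 (by simp [h])
  -- It suffices to split off a quadratic factor `|x - z|²`.
  have step : ∀ (z : ℂ) (G R : ℝ[X]), (∀ x : ℝ, R.eval x = ‖(x : ℂ) - z‖ ^ 2) →
      R.natDegree = 2 → H = R * G → (∀ x, 0 ≤ G.eval x) →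
      ∃ K : ℂ[X], ∀ x : ℝ, ‖K.eval (x : ℂ)‖ ^ 2 = H.eval x := by
    intro z G R hR hR2 hRG hG
    have hR0 : R ≠ 0 := fun h => by simp [h] at hR2
    have hG0 : G ≠ 0 := fun h => hne (by rw [hRG, h, mul_zero])
    have hlt : G.natDegree < H.natDegree := by
      rw [hRG, natDegree_mul hR0 hG0]
      omega
    obtain ⟨K, hK⟩ := ih _ hlt G hG rfl
    refine ⟨(X - C z) * K, fun x => ?_⟩
    rw [hRG, eval_mul, eval_mul, norm_mul, mul_pow, hK, hR, eval_sub, eval_X, eval_C]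
  -- Away from one point, nonnegativity of `H` passes to the cofactor; continuity does the rest.
  have nonneg_of : ∀ (G : ℝ[X]) (x₀ : ℝ), (∀ x ≠ x₀, 0 ≤ G.eval x) → ∀ x, 0 ≤ G.eval x := by
    intro G x₀ hG x
    have hcl : IsClosed {x : ℝ | 0 ≤ G.eval x} := isClosed_le continuous_const G.continuous
    have hd : Dense {x : ℝ | 0 ≤ G.eval x} := (dense_compl_singleton x₀).mono fun y hy => hG y hy
    have : x ∈ closure {x : ℝ | 0 ≤ G.eval x} := hd x
    rwa [hcl.closure_eq] at this
  obtain ⟨z, hz⟩ : ∃ z : ℂ, aeval z H = 0 := by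
    apply IsAlgClosed.exists_aeval_eq_zero
    exact fun h => h0 (natDegree_eq_of_degree_eq_some h)
  by_cases him : z.im = 0
  · obtain ⟨x₀, rfl⟩ : ∃ x₀ : ℝ, (x₀ : ℂ) = z := ⟨z.re, Complex.ext rfl him.symm⟩
    have hx₀ : H.eval x₀ = 0 := by
      rw [← Complex.coe_algebraMap, aeval_algebraMap_apply] at hz
      simpa using hz
    obtain ⟨F, hF⟩ := dvd_iff_isRoot.mpr (show H.IsRoot x₀ from hx₀)
    have hsign : ∀ x, 0 ≤ (x - x₀) * F.eval x := fun x => by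
      have := hH x
      rwa [hF, eval_mul, eval_sub, eval_X, eval_C] at this
    -- `F` changes sign at the root, so it vanishes there.
    have hF0 : F.eval x₀ = 0 := by
      apply le_antisymm
      · have hsub : Set.Iio x₀ ⊆ {x | F.eval x ≤ 0} := fun x hx =>
          nonpos_of_mul_nonneg_right (hsign x) (sub_neg.mpr hx)
        have := closure_minimal hsub (isClosed_le F.continuous continuous_const)
        rw [closure_Iio] at this
        exact this Set.self_mem_Iic
      · have hsub : Set.Ioi x₀ ⊆ {x | 0 ≤ F.eval x} := fun x hx =>
          nonneg_of_mul_nonneg_right (hsign x) (sub_pos.mpr hx)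
        have := closure_minimal hsub (isClosed_le continuous_const F.continuous)
        rw [closure_Ioi] at this
        exact this Set.self_mem_Ici
    obtain ⟨G, hG⟩ := dvd_iff_isRoot.mpr (show F.IsRoot x₀ from hF0)
    refine step x₀ G ((X - C x₀) ^ 2) (fun x => ?_) ?_ ?_ (nonneg_of G x₀ fun x hx => ?_)
    · rw [← Complex.ofReal_sub, Complex.norm_real, Real.norm_eq_abs, sq_abs]
      simp
    · rw [natDegree_pow, natDegree_X_sub_C]
    · rw [hF, hG]
      ring
    · have h1 := hH x
      rw [hF, hG, ← mul_assoc, ← sq, eval_mul, eval_pow, eval_sub, eval_X, eval_C] at h1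
      exact nonneg_of_mul_nonneg_right h1 (by have := sub_ne_zero.mpr hx; positivity)
  · obtain ⟨G, hG⟩ := quadratic_dvd_of_aeval_eq_zero_im_ne_zero H hz him
    have hR : ∀ x : ℝ, (X ^ 2 - C (2 * z.re) * X + C (‖z‖ ^ 2)).eval x = ‖(x : ℂ) - z‖ ^ 2 := by
      intro x
      rw [← Complex.normSq_eq_norm_sq, ← Complex.normSq_eq_norm_sq, Complex.normSq_apply,
        Complex.normSq_apply]
      simp
      ring
    refine step z G _ hR ?_ hG fun x => ?_
    · compute_degree!
    · have h1 := hH x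
      rw [hG, eval_mul, hR] at h1
      refine nonneg_of_mul_nonneg_right h1 ?_
      have : (x : ℂ) - z ≠ 0 := fun h => him (by rw [← sub_eq_zero.mp h, Complex.ofReal_im])
      positivity

/-! ### Approximation by members of admissible pairs -/

/-- Let `M` be odd. If `w` is a real polynomial with `x |w(x)|² ≤ 1` on `[0, 1]`, then
`V = x (1 - x^{2M}) w(x²) + i x^M` belongs to an admissible pair: in `y = x²` one has
`1 - |V|² = (1 - y) (∑_{k < M} y^k) (1 - y (1 - y^M) w(y)²)`, where the last two factors are
nonnegative for all real `y`. The imaginary part makes `|V(±1)| = 1`. -/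
theorem exists_isQSPPair (k : ℕ) (w : ℝ[X]) (hw : ∀ y ∈ Set.Icc (0 : ℝ) 1, y * w.eval y ^ 2 ≤ 1) :
    ∃ (D : ℕ) (V Q : ℂ[X]), IsQSPPair D V Q ∧ ∀ x : ℝ, V.eval (x : ℂ) =
      ((x * (1 - x ^ (2 * (2 * k + 1))) * w.eval (x ^ 2) : ℝ) : ℂ) +
        ((x ^ (2 * k + 1) : ℝ) : ℂ) * Complex.I := by
  set M := 2 * k + 1 with hM
  have hodd : Odd M := ⟨k, rfl⟩
  set H : ℝ[X] := (∑ j ∈ Finset.range M, X ^ j) * (1 - X * (1 - X ^ M) * w ^ 2) with hHdef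
  have hHeval : ∀ y : ℝ, H.eval y =
      (∑ j ∈ Finset.range M, y ^ j) * (1 - y * (1 - y ^ M) * w.eval y ^ 2) := fun y => by
    simp [hHdef, eval_finsetSum]
  have hH : ∀ y : ℝ, 0 ≤ H.eval y := by
    intro y
    rw [hHeval]
    refine mul_nonneg hodd.geom_sum_pos.le (sub_nonneg.mpr ?_)
    rcases le_or_gt 0 y with h0 | h0
    · rcases le_or_gt y 1 with h1 | h1
      · have hp : y ^ M ≤ 1 := pow_le_one₀ h0 h1
        have hp' : 0 ≤ y ^ M := pow_nonneg h0 M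
        have := hw y ⟨h0, h1⟩
        nlinarith [mul_nonneg h0 (sq_nonneg (w.eval y))]
      · have hp : 1 ≤ y ^ M := one_le_pow₀ h1.le
        nlinarith [mul_nonneg (mul_nonneg h0 (sub_nonneg.mpr hp)) (sq_nonneg (w.eval y))]
    · have hp : y ^ M < 0 := hodd.pow_neg h0
      nlinarith [mul_nonneg (mul_nonneg (neg_nonneg.mpr h0.le) (by linarith : 0 ≤ 1 - y ^ M))
        (sq_nonneg (w.eval y))]
  obtain ⟨K, hK⟩ := exists_norm_sq_eval_eq H hH
  set T : ℂ[X] := (1 - X ^ M) * w.map (algebraMap ℝ ℂ) + C Complex.I * X ^ k with hT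
  have hweval : ∀ y : ℝ, (w.map (algebraMap ℝ ℂ)).eval (y : ℂ) = ((w.eval y : ℝ) : ℂ) := fun y => by
    rw [← Complex.coe_algebraMap, eval_map_algebraMap, aeval_algebraMap_apply]
    simp
  have hV : ∀ x : ℝ, (X * expand ℂ 2 T).eval (x : ℂ) =
      ((x * (1 - x ^ (2 * M)) * w.eval (x ^ 2) : ℝ) : ℂ) + ((x ^ M : ℝ) : ℂ) * Complex.I := by
    intro x
    rw [eval_mul, eval_X, expand_eval, hT, ← Complex.ofReal_pow]
    simp only [eval_add, eval_mul, eval_sub, eval_pow, eval_X, eval_one, eval_C, hweval]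
    push_cast
    rw [hM]
    ring
  -- Any odd number that bounds both degrees serves as the number of rounds.
  refine ⟨2 * (T.natDegree + K.natDegree) + 1, X * expand ℂ 2 T, expand ℂ 2 K,
    ⟨?_, ?_, ?_, ?_, ?_⟩, hV⟩
  · refine degree_le_of_natDegree_le (natDegree_mul_le.trans ?_)
    rw [natDegree_X, natDegree_expand]
    omega
  · refine degree_le_natDegree.trans_lt ?_
    rw [natDegree_expand]
    exact_mod_cast (by omega)
  · intro n
    contrapose!
    intro hn
    rcases n with _ | n
    · simp
    · rw [coeff_X_mul, coeff_expand two_pos, if_neg (by omega)]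
  · intro n
    contrapose!
    intro hn
    rw [coeff_expand two_pos, if_neg (by omega)]
  · intro x _
    rw [hV, expand_eval, ← Complex.ofReal_pow, hK, hHeval, ← Complex.normSq_eq_norm_sq,
      Complex.normSq_add_mul_I, ← mul_assoc, mul_neg_geom_sum (x ^ 2) M]
    ring

/-- A continuous real function with values in `[-1, 1]` on `[a, 1/4]`, `a > 0`, is
approximated by members of admissible pairs. -/
theorem exists_isQSPPair_near {f : ℝ → ℝ} {a τ : ℝ} (ha : 0 < a)
    (hf : ContinuousOn f (Set.Icc a (1 / 4))) (hb : ∀ x ∈ Set.Icc a (1 / 4), |f x| ≤ 1)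
    (hτ : 0 < τ) :
    ∃ (D : ℕ) (V Q : ℂ[X]), IsQSPPair D V Q ∧
      ∀ x ∈ Set.Icc a (1 / 4), ‖V.eval (x : ℂ) - (f x : ℂ)‖ ≤ τ := by
  rcases lt_or_ge (1 / 4) a with h4 | h4
  · obtain ⟨D, V, Q, h, -⟩ := exists_isQSPPair 0 0 (by simp)
    exact ⟨D, V, Q, h, fun x hx => absurd (hx.1.trans hx.2) (not_le.mpr h4)⟩
  -- `u` extends `f(√y) / √y` continuously to `[0, 1]`, with `√y |u(y)| ≤ 1`.
  set g : ℝ → ℝ := fun y => max a (min √y (1 / 4)) with hg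
  have hgmem : ∀ y, g y ∈ Set.Icc a (1 / 4) := fun y =>
    ⟨le_max_left _ _, max_le h4 (min_le_right _ _)⟩
  set u : ℝ → ℝ := fun y => f (g y) / max a √y with hu
  have hmax : ∀ y, 0 < max a √y := fun y => lt_max_of_lt_left ha
  have hcont : Continuous u := by
    refine Continuous.div ?_ (by fun_prop) fun y => (hmax y).ne'
    exact hf.comp_continuous (by fun_prop) hgmem
  have hubound : ∀ y, √y * |u y| ≤ 1 := by
    intro y
    rw [hu, abs_div, abs_of_pos (hmax y), mul_div_assoc', div_le_one (hmax y)]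
    have := hb _ (hgmem y)
    have h2 := le_max_right a √y
    nlinarith [Real.sqrt_nonneg y, abs_nonneg (f (g y))]
  -- The error has four parts of size `ν`: the Weierstrass approximation, its rescaling to modulus
  -- at most `1`, the factor `1 - x^{2M}`, and the imaginary part.
  obtain ⟨ν, hν, hντ⟩ : ∃ ν > 0, 4 * ν ≤ τ := ⟨τ / 4, by positivity, by linarith⟩
  obtain ⟨p, hp⟩ := exists_polynomial_near_of_continuousOn 0 1 u hcont.continuousOn ν hν
  obtain ⟨k, hk⟩ := exists_pow_lt_of_lt_one hν (show (1 / 4 : ℝ) < 1 by norm_num)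
  set w : ℝ[X] := C (1 + ν)⁻¹ * p with hw
  have hν1 : 0 < 1 + ν := by positivity
  have hwe : ∀ y, (1 + ν) * w.eval y = p.eval y := fun y => by
    rw [hw, eval_mul, eval_C, mul_inv_cancel_left₀ hν1.ne']
  have hwb : ∀ y ∈ Set.Icc (0 : ℝ) 1, √y * |w.eval y| ≤ 1 := by
    intro y hy
    have h1 : |p.eval y| ≤ |u y| + ν := by
      have := abs_sub_abs_le_abs_sub (p.eval y) (u y)
      linarith [hp y hy]
    have h2 : √y ≤ 1 := Real.sqrt_le_one.mpr hy.2
    have h3 : (1 + ν) * |w.eval y| = |p.eval y| := by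
      rw [← hwe, abs_mul, abs_of_pos hν1]
    have h4 : (1 + ν) * (√y * |w.eval y|) ≤ (1 + ν) * 1 := by
      calc _ = √y * |p.eval y| := by rw [← h3]; ring
        _ ≤ √y * (|u y| + ν) := by gcongr
        _ ≤ (1 + ν) * 1 := by nlinarith [hubound y]
    exact le_of_mul_le_mul_left h4 hν1
  obtain ⟨D, V, Q, hVQ, hV⟩ := exists_isQSPPair k w fun y hy => by
    have := hwb y hy
    calc y * w.eval y ^ 2 = (√y * |w.eval y|) ^ 2 := by
          rw [mul_pow, Real.sq_sqrt hy.1, sq_abs]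
      _ ≤ 1 := pow_le_one₀ (by positivity) this
  refine ⟨D, V, Q, hVQ, fun x hx => ?_⟩
  have hx0 : 0 < x := ha.trans_le hx.1
  have hx1 : x ≤ 1 := hx.2.trans (by norm_num)
  have hsq : √(x ^ 2) = x := Real.sqrt_sq hx0.le
  have hmem : x ^ 2 ∈ Set.Icc (0 : ℝ) 1 := ⟨by positivity, pow_le_one₀ hx0.le hx1⟩
  have hfx : f x = x * u (x ^ 2) := by
    simp only [hu, hg, hsq, min_eq_left hx.2, max_eq_right hx.1]
    field_simp
  have hxw : |x * w.eval (x ^ 2)| ≤ 1 := by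
    have := hwb _ hmem
    rwa [hsq, ← abs_of_pos hx0, ← abs_mul, abs_of_pos hx0] at this
  have hM : x ^ (2 * k + 1) ≤ ν := by
    calc x ^ (2 * k + 1) ≤ x ^ k := pow_le_pow_of_le_one hx0.le hx1 (by omega)
      _ ≤ (1 / 4) ^ k := pow_le_pow_left₀ hx0.le hx.2 k
      _ ≤ ν := hk.le
  have hM2 : x ^ (2 * (2 * k + 1)) ≤ ν :=
    (pow_le_pow_of_le_one hx0.le hx1 (by omega)).trans hM
  have happrox : |x * w.eval (x ^ 2) - f x| ≤ 2 * ν := by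
    have h1 : x * w.eval (x ^ 2) - f x =
        x * (p.eval (x ^ 2) - u (x ^ 2)) - ν * (x * w.eval (x ^ 2)) := by
      rw [hfx, ← hwe]
      ring
    rw [h1]
    refine (abs_sub _ _).trans ?_
    rw [abs_mul, abs_mul ν, abs_of_pos hx0, abs_of_pos hν]
    nlinarith [hp _ hmem, abs_nonneg (p.eval (x ^ 2) - u (x ^ 2))]
  have hre : |x * (1 - x ^ (2 * (2 * k + 1))) * w.eval (x ^ 2) - f x| ≤ 3 * ν := by
    have h1 : x * (1 - x ^ (2 * (2 * k + 1))) * w.eval (x ^ 2) - f x =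
        (x * w.eval (x ^ 2) - f x) - x ^ (2 * (2 * k + 1)) * (x * w.eval (x ^ 2)) := by ring
    rw [h1]
    refine (abs_sub _ _).trans ?_
    have h2 : 0 ≤ x ^ (2 * (2 * k + 1)) := by positivity
    rw [abs_mul (x ^ _), abs_of_nonneg h2]
    nlinarith [abs_nonneg (x * w.eval (x ^ 2))]
  have : V.eval (x : ℂ) - (f x : ℂ) =
      ((x * (1 - x ^ (2 * (2 * k + 1))) * w.eval (x ^ 2) - f x : ℝ) : ℂ) +
        ((x ^ (2 * k + 1) : ℝ) : ℂ) * Complex.I := by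
    rw [hV]
    push_cast
    ring
  rw [this]
  refine (norm_add_le _ _).trans ?_
  rw [norm_mul, Complex.norm_I, mul_one, Complex.norm_real, Complex.norm_real, Real.norm_eq_abs,
    Real.norm_of_nonneg (by positivity : 0 ≤ x ^ (2 * k + 1))]
  linarith

/-! ### The Lennard-Jones potential in the squared distance -/

/-- In the variable `x = r² / (4 d)`, the Lennard-Jones potential is a function continuous away
from `0`, since it depends on `r²` only. -/
lemma exists_isQSPPair_near_lennardJones {d : ℕ} (hd : 1 ≤ d) {ε σ δ lam τ : ℝ} (hδ : 0 < δ)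
    (hlam : 0 < lam) (hτ : 0 < τ)
    (hb : ∀ r ∈ Set.Icc δ √(d : ℝ), |lennardJones ε σ r| ≤ lam) :
    ∃ (D : ℕ) (V Q : ℂ[X]), IsQSPPair D V Q ∧ ∀ r ∈ Set.Icc δ √(d : ℝ),
      ‖V.eval ((r ^ 2 / distScale d : ℝ) : ℂ) - ((lennardJones ε σ r / lam : ℝ) : ℂ)‖ ≤ τ := by
  have hd0 : (0 : ℝ) < d := by exact_mod_cast hd
  have hs : 0 < distScale d := by rw [distScale]; positivity
  have hsd : distScale d = 4 * d := rfl
  set a : ℝ := δ ^ 2 / distScale d with ha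
  have ha0 : 0 < a := by positivity
  set f : ℝ → ℝ := fun x => lennardJones ε σ √(distScale d * x) / lam with hf
  have hmem : ∀ x ∈ Set.Icc a (1 / 4), √(distScale d * x) ∈ Set.Icc δ √(d : ℝ) := by
    intro x hx
    constructor
    · apply Real.le_sqrt_of_sq_le
      have := (div_le_iff₀ hs).mp hx.1
      linarith
    · apply Real.sqrt_le_sqrt
      rw [hsd]
      nlinarith [hx.2]
  have hfc : ContinuousOn f (Set.Icc a (1 / 4)) := by
    have hne : ∀ x ∈ Set.Icc a (1 / 4), √(distScale d * x) ≠ 0 := fun x hx =>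
      (hδ.trans_le (hmem x hx).1).ne'
    simp only [hf, lennardJones]
    fun_prop (disch := assumption)
  have hfb : ∀ x ∈ Set.Icc a (1 / 4), |f x| ≤ 1 := by
    intro x hx
    simp only [hf]
    rw [abs_div, abs_of_pos hlam, div_le_one hlam]
    exact hb _ (hmem x hx)
  obtain ⟨D, V, Q, hVQ, hV⟩ := exists_isQSPPair_near ha0 hfc hfb hτ
  refine ⟨D, V, Q, hVQ, fun r hr => ?_⟩
  have hr0 : 0 < r := hδ.trans_le hr.1
  have hx : r ^ 2 / distScale d ∈ Set.Icc a (1 / 4) := by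
    constructor
    · have := hr.1
      rw [ha]
      gcongr
    · rw [div_le_iff₀ hs, hsd]
      have : r ^ 2 ≤ d := (Real.le_sqrt hr0.le hd0.le).mp hr.2
      linarith
  have hfr : f (r ^ 2 / distScale d) = lennardJones ε σ r / lam := by
    simp only [hf]
    rw [mul_div_cancel₀ _ hs.ne', Real.sqrt_sq hr0.le]
  have := hV _ hx
  rwa [hfr] at this

end LJCircuit

end

theorem mainTheorem7 :
    (∀ (D : ℕ) (P Q : Polynomial ℂ), LJCircuit.IsQSPPair D P Q →
      ∃ φ : Fin (D + 1) → ℝ, ∀ d : ℕ, 1 ≤ d → LJCircuit.OutputsGradient d φ P) ∧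
    (∀ (d : ℕ), 1 ≤ d →
      ∀ (ε σ δ lam τ : ℝ), 0 < ε → 0 < σ → 0 < δ → 0 < lam → 0 < τ →
      (∀ r ∈ Set.Icc δ √(d : ℝ), |LJCircuit.lennardJones ε σ r| ≤ lam) →
      ∃ (D : ℕ) (V Q : Polynomial ℂ) (φ : Fin (D + 1) → ℝ),
        LJCircuit.IsQSPPair D V Q ∧
        (∀ r ∈ Set.Icc δ √(d : ℝ),
          ‖V.eval ((r ^ 2 / LJCircuit.distScale d : ℝ) : ℂ) -
            ((LJCircuit.lennardJones ε σ r / lam : ℝ) : ℂ)‖ ≤ τ) ∧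
        LJCircuit.OutputsGradient d φ V) := by
  refine ⟨fun D P Q h => ?_, fun d hd ε σ δ lam τ _ _ hδ hlam hτ hb => ?_⟩
  · obtain ⟨φ, hφ⟩ := h.exists_phases
    exact ⟨fun t => φ t, fun d hd => LJCircuit.outputsGradient_of_qspPoly hφ hd⟩
  · obtain ⟨D, V, Q, hVQ, hV⟩ := LJCircuit.exists_isQSPPair_near_lennardJones hd hδ hlam hτ hb
    obtain ⟨φ, hφ⟩ := hVQ.exists_phases
    exact ⟨D, V, Q, fun t => φ t, hVQ, hV, LJCircuit.outputsGradient_of_qspPoly hφ hd⟩
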